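/- Let $n\ge 0$ be an integer, let $(X_i)_{i\in I}$ be a family of nonempty topological spaces indexed by an arbitrary set $I$, and let $X=\prod_{i\in I}X_i$ carry the product topology. Suppose that every $X_i$ is locally $n$-connected. Then the following statements hold. (i) If $X$ is locally $n$-connected, then all but finitely many of the $X_i$ are $n$-connected. (ii) If all but finitely many of the $X_i$ are $n$-connected, then $X$ is semilocally $n$-connected. Here a space $Y$ is *$n$-connected* if it is path connected (in particular nonempty) and $\pi_k(Y,y)$ is trivial for all $1\le k\le n$ and all $y\in Y$. It is *locally $n$-connected* if for every $y\in Y$, every neighbourhood $U$ of $y$ contains a neighbourhood $V$ of $y$ such that the map $\pi_k(V,v)\to\pi_k(U,v)$ induced by inclusion is trivial for all $0\le k\le n$ and all $v\in V$. It is *semilocally $n$-connected* if every $y\in Y$ has a neighbourhood $U$ such that the map $\pi_n(U,y)\to\pi_n(Y,y)$ induced by inclusion is trivial. A map is trivial here if it sends every class to the class of the constant map. -/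

import Mathlib

open scoped Topology

universe u v

/-- The image `f ∘ γ`, based at `f x`, of an `n`-loop `γ` based at `x`. -/
def nLoopMap {X : Type u} {Y : Type v} [TopologicalSpace X] [TopologicalSpace Y]
    (n : ℕ) (f : C(X, Y)) (x : X) (γ : GenLoop (Fin n) X x) : GenLoop (Fin n) Y (f x) :=
  ⟨f.comp γ.1, fun y hy => congrArg f (γ.2 y hy)⟩

/-- The map `f_* : π_n(X, x) → π_n(Y, f x)` induced by a continuous map `f : X → Y`. -/
def piMap {X : Type u} {Y : Type v} [TopologicalSpace X] [TopologicalSpace Y]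
    (n : ℕ) (f : C(X, Y)) (x : X) : π_ n X x → π_ n Y (f x) :=
  Quotient.map (nLoopMap n f x) fun _ _ h => h.map fun H => H.compContinuousMap f

/-- `f_* : π_n(X, x) → π_n(Y, f x)` is trivial: every class is sent to the class of the constant
`n`-loop. (For `n = 0` this says that `f` maps `X` into the path component of `f x`.) -/
def PiMapTrivial {X : Type u} {Y : Type v} [TopologicalSpace X] [TopologicalSpace Y]
    (n : ℕ) (f : C(X, Y)) (x : X) : Prop :=
  ∀ a : π_ n X x, piMap n f x a = Quotient.mk _ GenLoop.const

/-- `X` is `n`-connected: it is path connected (in particular nonempty), and `π_k(X, x)` is trivial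
for all `1 ≤ k ≤ n` and all base points `x`. -/
def IsNConnected (n : ℕ) (X : Type u) [TopologicalSpace X] : Prop :=
  PathConnectedSpace X ∧ ∀ k : ℕ, 1 ≤ k → k ≤ n → ∀ x : X, Subsingleton (π_ k X x)

/-- `X` is locally `n`-connected (`LCⁿ`): every neighbourhood `U` of a point contains a neighbourhood
`V` of that point such that `π_k(V, y) → π_k(U, y)` is trivial for all `0 ≤ k ≤ n` and `y ∈ V`. -/
def IsLocallyNConnected (n : ℕ) (X : Type u) [TopologicalSpace X] : Prop :=
  ∀ x : X, ∀ U ∈ 𝓝 x, ∃ V ∈ 𝓝 x, ∃ h : V ⊆ U, ∀ k : ℕ, k ≤ n → ∀ y : V,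
    PiMapTrivial k (ContinuousMap.inclusion h) y

/-- `X` is semilocally `n`-connected at `x`: there is a neighbourhood `U` of `x` such that
`π_n(U, x) → π_n(X, x)` is trivial. -/
def IsSemilocallyNConnectedAt (n : ℕ) (X : Type u) [TopologicalSpace X] (x : X) : Prop :=
  ∃ U : Set X, ∃ h : U ∈ 𝓝 x,
    PiMapTrivial n (⟨Subtype.val, continuous_subtype_val⟩ : C(U, X)) ⟨x, mem_of_mem_nhds h⟩

/-- `X` is semilocally `n`-connected: it is so at each of its points. -/
def IsSemilocallyNConnected (n : ℕ) (X : Type u) [TopologicalSpace X] : Prop :=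
  ∀ x : X, IsSemilocallyNConnectedAt n X x

open ContinuousMap

section Triviality

variable {X : Type u} {Y : Type v} [TopologicalSpace X] [TopologicalSpace Y]

/-! For (i), a neighbourhood in the product contains whole slices in all but finitely many
directions. Each factor is a retract of its slice, so local triviality of `π_k` kills `π_k` of these
factors (`subsingleton_pi_of_update_mem`). For (ii), coordinatewise null-homotopies assemble into
one; only the finitely many factors that are not `n`-connected require a small neighbourhood
(`isSemilocallyNConnected_pi`). -/

theorem piMapTrivial_iff_homotopicRel_const {n : ℕ} {f : C(X, Y)} {x : X} :
    PiMapTrivial n f x ↔ ∀ g : C(Fin n → unitInterval, X), (∀ t ∈ Cube.boundary (Fin n), g t = x) →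
      (f.comp g).HomotopicRel (const _ (f x)) (Cube.boundary (Fin n)) := by
  constructor
  · intro h g hg
    exact Quotient.exact (h (Quotient.mk _ ⟨g, hg⟩))
  · rintro h ⟨γ⟩
    exact Quotient.sound (h γ.1 γ.2)

theorem subsingleton_pi_iff_homotopicRel_const {n : ℕ} {x : X} :
    Subsingleton (π_ n X x) ↔
      ∀ g : C(Fin n → unitInterval, X), (∀ t ∈ Cube.boundary (Fin n), g t = x) →
        g.HomotopicRel (const _ x) (Cube.boundary (Fin n)) := by
  constructor
  · intro h g hg
    exact Quotient.exact (h.elim (Quotient.mk _ ⟨g, hg⟩) (Quotient.mk _ GenLoop.const))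
  · intro h
    refine ⟨?_⟩
    rintro ⟨γ⟩ ⟨δ⟩
    exact Quotient.sound ((h γ.1 γ.2).trans (h δ.1 δ.2).symm)

/-- `n`-connectedness, with path connectedness expressed through the triviality of `π₀`. -/
theorem isNConnected_iff_subsingleton_pi {n : ℕ} :
    IsNConnected n X ↔ Nonempty X ∧ ∀ k ≤ n, ∀ x : X, Subsingleton (π_ k X x) := by
  constructor
  · rintro ⟨hp, h⟩
    refine ⟨hp.nonempty, fun k hk x => ?_⟩
    rcases Nat.eq_zero_or_pos k with rfl | hk0
    · have := (pathConnectedSpace_iff_zerothHomotopy.1 hp).2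
      exact (HomotopyGroup.pi0EquivZerothHomotopy (x := x)).subsingleton
    · exact h k hk0 hk x
  · rintro ⟨⟨x⟩, h⟩
    refine ⟨pathConnectedSpace_iff_zerothHomotopy.2 ⟨⟨⟦x⟧⟩, ?_⟩, fun k _ hk x => h k hk x⟩
    have := h 0 n.zero_le x
    exact (HomotopyGroup.pi0EquivZerothHomotopy (x := x)).symm.subsingleton

end Triviality

section Product

variable {I : Type u} {X : I → Type v} [∀ i, TopologicalSpace (X i)]

/-- A neighbourhood of a point in a product contains, for all but finitely many `i`, the whole slice
through that point in the direction `i`. -/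
theorem finite_setOf_exists_update_notMem [DecidableEq I] {x : ∀ i, X i} {V : Set (∀ i, X i)}
    (hV : V ∈ 𝓝 x) : {i : I | ∃ a : X i, Function.update x i a ∉ V}.Finite := by
  rw [nhds_pi, Filter.mem_pi] at hV
  obtain ⟨F, hF, W, hW, hWV⟩ := hV
  refine hF.subset ?_
  rintro i ⟨a, ha⟩
  by_contra hi
  refine ha (hWV fun j hj => ?_)
  rw [Function.update_of_ne (ne_of_mem_of_not_mem hj hi)]
  exact mem_of_mem_nhds (hW j)

/-- If a set `V` contains the slice through `x` in the direction `i` and `V ⊆ U` is trivial on `π_k`,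
then `π_k (X i)` is trivial. -/
theorem subsingleton_pi_of_update_mem [DecidableEq I] {k : ℕ} {x : ∀ i, X i} {i : I}
    {U V : Set (∀ i, X i)} (hVU : V ⊆ U) (hi : ∀ a : X i, Function.update x i a ∈ V)
    (h : ∀ y : V, PiMapTrivial k (ContinuousMap.inclusion hVU) y) (a : X i) :
    Subsingleton (π_ k (X i) a) := by
  rw [subsingleton_pi_iff_homotopicRel_const]
  intro g hg
  let slice : C(X i, V) :=
    ⟨fun b => ⟨Function.update x i b, hi b⟩, by fun_prop⟩
  let proj : C(U, X i) := ⟨fun z => z.1 i, (continuous_apply i).comp continuous_subtype_val⟩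
  -- The identity of `X i` factors through `V ⊆ U`, so a null-homotopy in `U` projects to one in `X
  -- i`.
  have hproj : ∀ b, proj (ContinuousMap.inclusion hVU (slice b)) = b :=
    fun b => Function.update_self i b x
  have hg' : proj.comp ((ContinuousMap.inclusion hVU).comp (slice.comp g)) = g :=
    ContinuousMap.ext fun t => hproj (g t)
  have ha : proj.comp (const (Fin k → unitInterval) (ContinuousMap.inclusion hVU (slice a))) =
      const _ a := ContinuousMap.ext fun _ => hproj a
  rw [← hg', ← ha]
  exact (piMapTrivial_iff_homotopicRel_const.1 (h (slice a)) (slice.comp g)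
    fun t ht => congrArg slice (hg t ht)).map fun H => H.compContinuousMap proj

theorem finite_setOf_not_isNConnected_of_isLocallyNConnected_pi [∀ i, Nonempty (X i)] {n : ℕ}
    (h : IsLocallyNConnected n (∀ i, X i)) : {i : I | ¬ IsNConnected n (X i)}.Finite := by
  classical
  let x : ∀ i, X i := Classical.arbitrary _
  obtain ⟨V, hV, hVU, hVt⟩ := h x Set.univ Filter.univ_mem
  refine (finite_setOf_exists_update_notMem hV).subset fun i hi => ?_
  by_contra hmem
  simp only [Set.mem_ofPred_eq, not_exists, not_not] at hmem
  exact hi (isNConnected_iff_subsingleton_pi.2 ⟨inferInstance, fun k hk a =>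
    subsingleton_pi_of_update_mem hVU hmem (hVt k hk) a⟩)

theorem IsLocallyNConnected.isSemilocallyNConnected {Y : Type v} [TopologicalSpace Y] {n : ℕ}
    (h : IsLocallyNConnected n Y) : IsSemilocallyNConnected n Y := by
  intro y
  obtain ⟨V, hV, hVU, hVt⟩ := h y Set.univ Filter.univ_mem
  refine ⟨V, hV, piMapTrivial_iff_homotopicRel_const.2 fun g hg => ?_⟩
  exact (piMapTrivial_iff_homotopicRel_const.1 (hVt n le_rfl ⟨y, mem_of_mem_nhds hV⟩) g hg).map
    fun H => H.compContinuousMap (⟨Subtype.val, continuous_subtype_val⟩ : C(Set.univ, Y))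

theorem isSemilocallyNConnected_pi {n : ℕ} (hX : ∀ i, IsSemilocallyNConnected n (X i))
    (hfin : {i : I | ¬ IsNConnected n (X i)}.Finite) :
    IsSemilocallyNConnected n (∀ i, X i) := by
  intro x
  choose V hV hVt using fun i => hX i (x i)
  -- The box leaves the `n`-connected coordinates free, so finiteness makes it a neighbourhood.
  refine ⟨{i : I | ¬ IsNConnected n (X i)}.pi V, set_pi_mem_nhds hfin fun i _ => hV i,
    piMapTrivial_iff_homotopicRel_const.2 fun g hg => ?_⟩
  have hcont : ∀ i, Continuous fun t => (g t).1 i := fun i =>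
    (continuous_apply i).comp (continuous_subtype_val.comp g.continuous)
  have key : ∀ i, (⟨fun t => (g t).1 i, hcont i⟩ : C(Fin n → unitInterval, X i)).HomotopicRel
      (const _ (x i)) (Cube.boundary (Fin n)) := by
    intro i
    by_cases hi : IsNConnected n (X i)
    · exact subsingleton_pi_iff_homotopicRel_const.1
        ((isNConnected_iff_subsingleton_pi.1 hi).2 n le_rfl (x i)) _
        fun t ht => by simp [hg t ht]
    · exact piMapTrivial_iff_homotopicRel_const.1 (hVt i)
        ⟨fun t => ⟨(g t).1 i, (g t).2 i hi⟩, (hcont i).subtype_mk _⟩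
        fun t ht => by simp [hg t ht]
  -- Each chosen homotopy fixes the boundary, hence so does their product.
  exact ⟨HomotopyRel.pi fun i => (key i).some⟩

end Product

theorem corollary2p11 {I : Type u} (X : I → Type v) [∀ i, TopologicalSpace (X i)]
    [∀ i, Nonempty (X i)] (n : ℕ) (hX : ∀ i, IsLocallyNConnected n (X i)) :
    (IsLocallyNConnected n (∀ i, X i) → {i : I | ¬ IsNConnected n (X i)}.Finite) ∧
      ({i : I | ¬ IsNConnected n (X i)}.Finite → IsSemilocallyNConnected n (∀ i, X i)) :=
  ⟨finite_setOf_not_isNConnected_of_isLocallyNConnected_pi,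
    isSemilocallyNConnected_pi fun i => (hX i).isSemilocallyNConnected⟩
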